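/- **Setting.** Let $p,d,n\ge 0$ and $0\le r\le p$ be integers and $\sigma>0$. A $d$-layer parameter with input dimension $p$ is a tuple $\theta=(w_0,W_1,\dots,W_d)$ with $w_0\in\mathbb R^{n_0}$, $W_i\in\mathbb R^{n_i\times n_{i-1}}$, where $n_0=n_d=p$ and the hidden layer sizes $n_1,\dots,n_{d-1}$ are arbitrary; $\mathcal F_{p,d}$ is the set of all of them. Given $\theta$, a measurable activation $\varphi:\mathbb R\to\mathbb R$ (applied entrywise), a probability law of a label $y\in\{-1,+1\}$ and probability laws of noise vectors $e_i\in\mathbb R^{n_i}$, $0\le i\le d$, with $y,e_0,\dots,e_d$ independent, the network generates $(x,y)\in\mathbb R^p\times\{-1,+1\}$ by $$z_0=y\,w_0+e_0,\qquad z_i=W_i\,\varphi(z_{i-1})+e_i\ (1\le i\le d),\qquad x=z_d .$$ Let $\mathcal P_{(x,y)|\theta}$ be the set of all laws of $(x,y)$ obtained in this way from $\theta$. Let $\mathcal P$ be the set of all joint laws $\mathbb P(\theta,S)=\mathbb P(\theta)\,\mathbb P^n((x,y)\mid\theta)$ of a parameter and a dataset $S\in(\mathbb R^p\times\{-1,+1\})^n$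 whose entries are i.i.d. given $\theta$, where the prior $\mathbb P(\theta)$ is any probability law on $\mathcal F_{p,d}$ and $\mathbb P((x,y)\mid\theta)\in\mathcal P_{(x,y)|\theta}$ for almost every $\theta$. Let $\mathcal G_{p,d,r}\subseteq\mathcal F_{p,d}$ be the finite set of parameters with all layers of size $p$, with $w_0\in\prod_{j=1}^{p-1}\{\pm 2^{-j/2}\}\times\{\pm 2^{-(p-1)/2}\}$ and with each $W_i=\begin{pmatrix}R_i&0\\0&c\,I_{p-r}\end{pmatrix}$, where $R_i$ is an $r\times r$ permutation matrix and $c=\frac1{p-r+1}$. Let $\mathcal P'$ be the set of joint laws as above with prior $\mathrm{Uniform}(\mathcal G_{p,d,r})$, identity activation, $y$ uniform on $\{-1,+1\}$ and $e_i\sim N(0,\sigma^2 I_{n_i})$. For a decoder $\hat f:(\mathbb R^p\times\{-1,+1\})^n\to\mathcal F_{p,d}$ (any function; $\Psi(\mathcal F_{p,d})$ is the set of all of them) put $\xi_1(\hat f,\mathbb P)=P_{(\theta^*,S)\sim\mathbb P}\big(\hat f(S)\ne\theta^*\big)$, read as an outer probability if $\hat f$ is not measurable. **Theorem 3.2.**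 If $$n\le\sigma^2\,\frac{d\sum_{i=1}^r\log i+p\log 2-\log 4}{4},$$ then $$\inf_{\hat f\in\Psi(\mathcal F_{p,d})}\ \sup_{\mathbb P\in\mathcal P}\ \xi_1(\hat f,\mathbb P)\ \ge\ \frac12 .$$ Moreover $\mathcal P'\subseteq\mathcal P$, and the bound already holds over $\mathcal P'$: $\ \inf_{\hat f\in\Psi(\mathcal F_{p,d})}\sup_{\mathbb P\in\mathcal P'}\xi_1(\hat f,\mathbb P)\ge\frac12$. -/

import Mathlib

open MeasureTheory ProbabilityTheory
open scoped ENNReal NNReal Matrix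

namespace DeepNet

/-- The product (Borel) σ-algebra on real matrices. -/
instance instMeasurableSpaceMatrix (k l : ℕ) : MeasurableSpace (Matrix (Fin k) (Fin l) ℝ) :=
  inferInstanceAs (MeasurableSpace (Fin k → Fin l → ℝ))

/-- The label set `{-1, +1} ⊆ ℝ`. -/
abbrev Label : Type := ({-1, 1} : Set ℝ)

/-- A single observation `(x, y) ∈ ℝ^p × {-1, +1}`. -/
abbrev Obs (p : ℕ) : Type := (Fin p → ℝ) × Label

/-- Layer sizes `n_0, …, n_d` of a `d`-layer network with input dimension `p`: the first and the
last are `p`, the hidden ones are arbitrary. -/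
abbrev Widths (p d : ℕ) : Type :=
  {m : Fin (d + 1) → ℕ // m 0 = p ∧ m (Fin.last d) = p}

/-- The class `F_{p,d}` of all parameters `(w_0, W_1, …, W_d)` of `d`-layer networks with input
dimension `p`: `w_0 ∈ ℝ^{n_0}` and `W_i ∈ ℝ^{n_i × n_{i-1}}`, where `(n_0, …, n_d)` are the layer
sizes. The matrix `W_{i+1}` is the entry of index `i : Fin d`. -/
abbrev Param (p d : ℕ) : Type :=
  Σ m : Widths p d,
    (Fin (m.1 0) → ℝ) × (∀ i : Fin d, Matrix (Fin (m.1 i.succ)) (Fin (m.1 i.castSucc)) ℝ)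

/-- The states of the backward network with activation `φ`, parameter `θ`, label `y` and noise
vectors `e_0, …, e_d`: `z_0 = y w_0 + e_0` and `z_i = W_i φ(z_{i-1}) + e_i`, with `φ` applied
entrywise. -/
noncomputable def state {p d : ℕ} (φ : ℝ → ℝ) (θ : Param p d) (y : ℝ)
    (e : ∀ i : Fin (d + 1), Fin (θ.1.1 i) → ℝ) (i : Fin (d + 1)) : Fin (θ.1.1 i) → ℝ :=
  Fin.induction (motive := fun i => Fin (θ.1.1 i) → ℝ) (y • θ.2.1 + e 0)
    (fun i z => θ.2.2 i *ᵥ (fun k => φ (z k)) + e i.succ) i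

/-- The generated input `x = z_d ∈ ℝ^p`. -/
noncomputable def output {p d : ℕ} (φ : ℝ → ℝ) (θ : Param p d) (y : ℝ)
    (e : ∀ i : Fin (d + 1), Fin (θ.1.1 i) → ℝ) : Fin p → ℝ :=
  fun j => state φ θ y e (Fin.last d) (Fin.cast θ.1.2.2.symm j)

/-- The law of `(x, y)` generated by the network with activation `φ` and parameter `θ`, when
`y` has law `lab`, the noise vector `e_i` has law `ν i`, and `y, e_0, …, e_d` are independent. -/
noncomputable def dataLaw {p d : ℕ} (φ : ℝ → ℝ) (lab : Measure Label) (θ : Param p d)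
    (ν : ∀ i : Fin (d + 1), Measure (Fin (θ.1.1 i) → ℝ)) : Measure (Obs p) :=
  (lab.prod (Measure.pi ν)).map (fun a => (output φ θ (a.1 : ℝ) a.2, a.1))

/-- The collection of all laws of `(x, y)` generated by networks with parameter `θ`, over all
(measurable) activations, all laws of the label and all laws of the noise vectors. -/
def allDataLaws {p d : ℕ} (θ : Param p d) : Set (Measure (Obs p)) :=
  {μ | ∃ φ : ℝ → ℝ, Measurable φ ∧
    ∃ lab : Measure Label, IsProbabilityMeasure lab ∧
    ∃ ν : ∀ i : Fin (d + 1), Measure (Fin (θ.1.1 i) → ℝ), (∀ i, IsProbabilityMeasure (ν i)) ∧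
      μ = dataLaw φ lab θ ν}

/-- The collection whose only element is the law of `(x, y)` for the identity activation, a
uniform label and noise vectors `e_i ∼ N(0, σ² I)`; that is, `z_0 | y ∼ N(y w_0, σ² I)` and
`z_i | z_{i-1} ∼ N(W_i z_{i-1}, σ² I)`. -/
noncomputable def linearGaussianLaws {p d : ℕ} (σ : ℝ) (θ : Param p d) : Set (Measure (Obs p)) :=
  {dataLaw id (uniformOn (Set.univ : Set Label)) θ
    (fun _ => Measure.pi (fun _ => gaussianReal 0 (σ ^ 2).toNNReal))}

/-- The joint laws `ℙ(θ, S) = ℙ(θ) ℙⁿ((x, y) | θ)` of the parameter and a dataset of `n`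
observations that are i.i.d. given `θ`, with prior `ℙ(θ)` in `Pri` and `ℙ((x, y) | θ)` in `K θ`
(the conditional law being determined up to null sets of the prior). -/
def jointLaws {p d : ℕ} (n : ℕ) (Pri : Set (Measure (Param p d)))
    (K : Param p d → Set (Measure (Obs p))) : Set (Measure (Param p d × (Fin n → Obs p))) :=
  {P | ∃ π ∈ Pri, ∃ κ : Kernel (Param p d) (Fin n → Obs p), IsMarkovKernel κ ∧
    (∀ᵐ θ ∂π, ∃ μ ∈ K θ, κ θ = Measure.pi (fun _ => μ)) ∧ P = π ⊗ₘ κ}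

/-- The full family: every prior on `F_{p,d}`, every activation, every data distribution. -/
def fullFamily (p d n : ℕ) : Set (Measure (Param p d × (Fin n → Obs p))) :=
  jointLaws n {π | IsProbabilityMeasure π} allDataLaws

/-- The block diagonal `p × p` matrix with blocks the permutation matrix of `τ` and `c I_{p-r}`,
where `c = 1 / (p - r + 1)`. -/
noncomputable def blockMatrix {p r : ℕ} (hr : r ≤ p) (τ : Equiv.Perm (Fin r)) :
    Matrix (Fin p) (Fin p) ℝ :=
  let e : Fin p ≃ Fin r ⊕ Fin (p - r) :=
    (finCongr (Nat.add_sub_of_le hr).symm).trans finSumFinEquiv.symm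
  (Matrix.fromBlocks (τ.permMatrix ℝ) 0 0
    ((1 / ((p : ℝ) - r + 1)) • (1 : Matrix (Fin (p - r)) (Fin (p - r)) ℝ))).submatrix e e

/-- The vectors of `∏_j {±1/√(2^j)}`, `j = 1, …, p - 1`, times `{±1/√(2^(p-1))}`. -/
def signVectors (p : ℕ) : Set (Fin p → ℝ) :=
  {w | ∀ j : Fin p, w j = 1 / √(2 ^ min (j.val + 1) (p - 1)) ∨
    w j = -1 / √(2 ^ min (j.val + 1) (p - 1))}

/-- The finite subclass `G_{p,d,r}` of `F_{p,d}`: all layers have size `p`, `w_0` is one of the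
`2^p` sign vectors and each `W_i` is one of the `r!` block matrices. -/
def subclass {p r : ℕ} (d : ℕ) (hr : r ≤ p) : Set (Param p d) :=
  {θ | ∃ (w : Fin p → ℝ) (τ : Fin d → Equiv.Perm (Fin r)), w ∈ signVectors p ∧
    θ = ⟨⟨fun _ => p, rfl, rfl⟩, (w, fun i => blockMatrix hr (τ i))⟩}

/-- The subfamily with prior `Uniform(G_{p,d,r})` and linear Gaussian data. -/
def subFamily {p r : ℕ} (d n : ℕ) (hr : r ≤ p) (σ : ℝ) :
    Set (Measure (Param p d × (Fin n → Obs p))) :=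
  jointLaws n {uniformOn (subclass d hr)} (linearGaussianLaws σ)

/-- The probability under `P` that the decoder `f` fails to recover the exact parameter (an outer
measure if the decoder is not measurable). -/
noncomputable def failureProb {p d n : ℕ} (f : (Fin n → Obs p) → Param p d)
    (P : Measure (Param p d × (Fin n → Obs p))) : ℝ≥0∞ :=
  P {q | f q.2 ≠ q.1}

/-- The minimax failure probability over a family of joint laws; the infimum is over all functions
from datasets to `F_{p,d}`. -/
noncomputable def minimaxFailure {p d n : ℕ}
    (C : Set (Measure (Param p d × (Fin n → Obs p)))) : ℝ≥0∞ :=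
  ⨅ f : (Fin n → Obs p) → Param p d, ⨆ P ∈ C, failureProb f P

end DeepNet

/-!
Recovering `θ` from the data is a test between the `M = 2 ^ p * (r !) ^ d` parameters of
`subclass`. The lower bound is a second-moment argument against one common reference law.

*Reference law.* For a parameter of `subclass` every `W_i` permutes the first `r` coordinates and
then applies a fixed diagonal matrix commuting with that permutation. Pulling the permutations back
onto the noise vectors, which only relabels i.i.d. Gaussian coordinates, shows that without the
signal (`w_0 = 0`) the law of an observation is the same for every parameter (`nullLaw`). The signal
shifts the first noise vector by `y w_0`, with `‖w_0‖² ≤ 1`, so the likelihood ratio of the data law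
to `nullLaw` has second moment at most `exp (1 / σ²)` (`secondMomentDominated_dataLaw`), and that of
`n` i.i.d. observations at most `c = exp (1 / σ²) ^ n`. The bookkeeping uses the relation
`SecondMomentDominated`, which tensorizes and passes to images, so no density of the output is
needed.

*Testing.* If a decoder succeeds on disjoint events `A_θ`, Cauchy–Schwarz gives
`(∑ P_θ A_θ)² ≤ M ∑ (P_θ A_θ)² ≤ M c ∑ Q A_θ ≤ M c`, so the average success probability is at most
`√(c / M)` (`half_le_failure_of_dominated`). The assumption on `n` says `M ≥ 4 exp (4 n / σ²)`, hence
`4 c ≤ M` (`exp_le_card`), and the success probability is at most `1 / 2`.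
-/

namespace DeepNet

/-! ### Domination in second moment -/

section Domination

variable {α β : Type*} [MeasurableSpace α] [MeasurableSpace β]

/-- Cauchy–Schwarz for nonnegative functions, with `h = √(a b)`. -/
lemma sq_lintegral_le_mul {μ : Measure α} {h a b : α → ℝ≥0∞} (ha : Measurable a)
    (hb : Measurable b) (hab : ∀ x, h x ^ 2 = a x * b x) :
    (∫⁻ x, h x ∂μ) ^ 2 ≤ (∫⁻ x, a x ∂μ) * ∫⁻ x, b x ∂μ := by
  have hroot : ∀ u : ℝ≥0∞, (u ^ (1 / 2 : ℝ)) ^ 2 = u := fun u => by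
    rw [← ENNReal.rpow_natCast, ← ENNReal.rpow_mul]; norm_num
  have hh : ∀ x, h x = a x ^ (1 / 2 : ℝ) * b x ^ (1 / 2 : ℝ) := fun x => by
    rw [← ENNReal.mul_rpow_of_nonneg _ _ (by norm_num), ← hab, ← ENNReal.rpow_natCast,
      ← ENNReal.rpow_mul]
    norm_num
  have key := ENNReal.lintegral_mul_norm_pow_le (μ := μ) ha.aemeasurable hb.aemeasurable
    (p := 1 / 2) (q := 1 / 2) (by norm_num) (by norm_num) (by norm_num)
  calc (∫⁻ x, h x ∂μ) ^ 2 = (∫⁻ x, a x ^ (1 / 2 : ℝ) * b x ^ (1 / 2 : ℝ) ∂μ) ^ 2 := by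
        simp_rw [hh]
    _ ≤ ((∫⁻ x, a x ∂μ) ^ (1 / 2 : ℝ) * (∫⁻ x, b x ∂μ) ^ (1 / 2 : ℝ)) ^ 2 := by gcongr
    _ = _ := by rw [mul_pow, hroot, hroot]

/-- `μ` is dominated by `ν` in second moment with constant `C`: `(∫ f dμ)² ≤ C ∫ f² dν` for all
nonnegative measurable `f`. For σ-finite `ν`, by duality in `L²(ν)`, this says that `μ` has a
density with respect to `ν` whose second moment, `1 + χ²(μ ‖ ν)` for probability measures, is at
most `C`; the dual form needs no density and passes to images and products directly. -/
def SecondMomentDominated (μ ν : Measure α) (C : ℝ≥0∞) : Prop :=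
  ∀ f : α → ℝ≥0∞, Measurable f → (∫⁻ x, f x ∂μ) ^ 2 ≤ C * ∫⁻ x, f x ^ 2 ∂ν

namespace SecondMomentDominated

lemma refl (μ : Measure α) [IsProbabilityMeasure μ] : SecondMomentDominated μ μ 1 := by
  intro f hf
  have := sq_lintegral_le_mul (μ := μ) (h := f) (hf.pow_const 2) (measurable_const (a := 1))
    (by simp)
  simpa [mul_comm] using this

lemma mono {μ ν : Measure α} {C C' : ℝ≥0∞} (h : SecondMomentDominated μ ν C) (hC : C ≤ C') :
    SecondMomentDominated μ ν C' :=
  fun f hf => (h f hf).trans (by gcongr)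

lemma map {μ ν : Measure α} {C : ℝ≥0∞} (h : SecondMomentDominated μ ν C) {T : α → β}
    (hT : Measurable T) : SecondMomentDominated (μ.map T) (ν.map T) C := by
  intro f hf
  rw [lintegral_map hf hT, lintegral_map (hf.pow_const 2) hT]
  exact h _ (hf.comp hT)

lemma prod {μ ν : Measure α} {μ' ν' : Measure β} [SFinite μ'] [SFinite ν'] {C C' : ℝ≥0∞}
    (h : SecondMomentDominated μ ν C) (h' : SecondMomentDominated μ' ν' C') :
    SecondMomentDominated (μ.prod μ') (ν.prod ν') (C * C') := by
  intro f hf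
  rw [lintegral_prod _ hf.aemeasurable, lintegral_prod _ (hf.pow_const 2).aemeasurable, mul_assoc]
  refine (h _ hf.lintegral_prod_right').trans ?_
  rw [← lintegral_const_mul _ (hf.pow_const 2).lintegral_prod_right']
  gcongr with x
  exact h' _ (hf.comp measurable_prodMk_left)

lemma pi {k : ℕ} {X : Fin k → Type*} [∀ i, MeasurableSpace (X i)] {μ ν : ∀ i, Measure (X i)}
    [∀ i, SigmaFinite (μ i)] [∀ i, SigmaFinite (ν i)] {C : Fin k → ℝ≥0∞}
    (h : ∀ i, SecondMomentDominated (μ i) (ν i) (C i)) :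
    SecondMomentDominated (Measure.pi μ) (Measure.pi ν) (∏ i, C i) := by
  induction k with
  | zero =>
    rw [Measure.pi_of_empty μ (fun i => i.elim0), Measure.pi_of_empty ν (fun i => i.elim0)]
    simpa using refl _
  | succ k ih =>
    have := ((h 0).prod (ih (fun j => h j.succ))).map
      (MeasurableEquiv.piFinSuccAbove X 0).symm.measurable
    rw [Fin.prod_univ_succ]
    convert this using 1
    · exact ((measurePreserving_piFinSuccAbove μ 0).symm _).map_eq.symm
    · exact ((measurePreserving_piFinSuccAbove ν 0).symm _).map_eq.symm

/-- A mixture over a common component: if `T y` maps `ν` to a law dominated by `ρ` with the same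
constant for every `y`, the joint law of `T y` and `y` is dominated by the product law. -/
lemma map_prodMk {lab : Measure β} [IsProbabilityMeasure lab] {ν : Measure α} [SFinite ν]
    {γ : Type*} [MeasurableSpace γ] {ρ : Measure γ} [SFinite ρ] {C : ℝ≥0∞} {T : β × α → γ}
    (hT : Measurable T)
    (h : ∀ y, SecondMomentDominated (ν.map (fun e => T (y, e))) ρ C) :
    SecondMomentDominated ((lab.prod ν).map (fun a => (T a, a.1))) (ρ.prod lab) C := by
  intro f hf
  have hTm : Measurable (fun a : β × α => (T a, a.1)) := hT.prodMk measurable_fst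
  have hg : Measurable (fun a : β × α => f (T a, a.1)) := hf.comp hTm
  rw [lintegral_map hf hTm, lintegral_prod _ hg.aemeasurable,
    lintegral_prod_symm' _ (hf.pow_const 2),
    ← lintegral_const_mul _ (hf.pow_const 2).lintegral_prod_left']
  refine (refl lab _ hg.lintegral_prod_right').trans ?_
  rw [one_mul]
  gcongr with y
  have hy : Measurable (fun x => f (x, y)) := hf.comp measurable_prodMk_right
  have := h y _ hy
  rwa [lintegral_map hy (show Measurable (fun e => T (y, e)) from
    hT.comp measurable_prodMk_left)] at this

lemma measureReal_sq_le {μ ν : Measure α} [IsFiniteMeasure μ] [IsFiniteMeasure ν] {c : ℝ}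
    (hc : 0 ≤ c) (h : SecondMomentDominated μ ν (ENNReal.ofReal c)) {A : Set α}
    (hA : MeasurableSet A) : μ.real A ^ 2 ≤ c * ν.real A := by
  have := h (A.indicator 1) (measurable_one.indicator hA)
  have hsq : ∀ x, A.indicator (1 : α → ℝ≥0∞) x ^ 2 = A.indicator 1 x := fun x => by
    by_cases hx : x ∈ A <;> simp [hx]
  simp_rw [hsq, lintegral_indicator_one hA] at this
  have := ENNReal.toReal_mono (by finiteness) this
  simpa [Measure.real, hc] using this

end SecondMomentDominated

/-- The constant is the exact second moment `∫ g_m² / g_0` of the likelihood ratio, read off from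
the identity `g_m² = exp (m² / v) g_0 g_{2m}` between Gaussian densities. -/
lemma secondMomentDominated_gaussianReal (m : ℝ) {v : ℝ≥0} (hv : v ≠ 0) :
    SecondMomentDominated (gaussianReal m v) (gaussianReal 0 v)
      (ENNReal.ofReal (Real.exp (m ^ 2 / v))) := by
  intro f hf
  have hv' : (v : ℝ) ≠ 0 := by exact_mod_cast hv
  have hpdf : ∀ x, gaussianPDF m v x ^ 2 =
      ENNReal.ofReal (Real.exp (m ^ 2 / v)) * gaussianPDF 0 v x * gaussianPDF (2 * m) v x := by
    intro x
    rw [gaussianPDF, gaussianPDF, gaussianPDF, ← ENNReal.ofReal_mul (by positivity),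
      ← ENNReal.ofReal_mul (mul_nonneg (by positivity) (gaussianPDFReal_nonneg _ _ _)),
      ← ENNReal.ofReal_pow (gaussianPDFReal_nonneg _ _ _)]
    congr 1
    simp only [gaussianPDFReal]
    have : Real.exp (-(x - m) ^ 2 / (2 * v)) ^ 2 = Real.exp (m ^ 2 / v) *
        Real.exp (-(x - 0) ^ 2 / (2 * v)) * Real.exp (-(x - 2 * m) ^ 2 / (2 * v)) := by
      rw [← Real.exp_add, ← Real.exp_add, ← Real.exp_nat_mul]
      congr 1
      field_simp
      push_cast
      ring
    rw [mul_pow, this]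
    ring
  have hm := measurable_gaussianPDF
  rw [gaussianReal_of_var_ne_zero _ hv, gaussianReal_of_var_ne_zero _ hv,
    lintegral_withDensity_eq_lintegral_mul _ (hm m v) hf,
    lintegral_withDensity_eq_lintegral_mul _ (hm 0 v) (hf.pow_const 2),
    ← lintegral_const_mul _ ((hm 0 v).mul (hf.pow_const 2))]
  refine (sq_lintegral_le_mul (a := fun x => ENNReal.ofReal (Real.exp (m ^ 2 / v)) *
    (gaussianPDF 0 v * fun x => f x ^ 2) x) (b := gaussianPDF (2 * m) v)
    (((hm 0 v).mul (hf.pow_const 2)).const_mul _) (hm _ _) fun x => ?_).trans ?_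
  · simp only [Pi.mul_apply]
    rw [mul_pow, hpdf]
    ring
  · rw [lintegral_gaussianPDF_eq_one _ hv, mul_one]

end Domination

/-! ### The block matrices -/

/-- Extension of a permutation of the first `r` of `p` coordinates by the identity. -/
def extendPerm {p r : ℕ} (hr : r ≤ p) (τ : Equiv.Perm (Fin r)) : Equiv.Perm (Fin p) :=
  ((finCongr (Nat.add_sub_of_le hr).symm).trans finSumFinEquiv.symm).symm.permCongr
    (Equiv.sumCongr τ (Equiv.refl (Fin (p - r))))

/-- The diagonal of `blockMatrix`: `1` on the first `r` coordinates and `1 / (p - r + 1)` on the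
others. -/
noncomputable def blockScale {p r : ℕ} (hr : r ≤ p) (j : Fin p) : ℝ :=
  Sum.elim (fun _ => (1 : ℝ)) (fun _ => 1 / ((p : ℝ) - r + 1))
    (((finCongr (Nat.add_sub_of_le hr).symm).trans finSumFinEquiv.symm) j)

lemma blockScale_extendPerm {p r : ℕ} (hr : r ≤ p) (τ : Equiv.Perm (Fin r)) (j : Fin p) :
    blockScale hr (extendPerm hr τ j) = blockScale hr j := by
  simp only [blockScale, extendPerm, Equiv.permCongr_apply, Equiv.symm_symm,
    Equiv.apply_symm_apply]
  generalize ((finCongr (Nat.add_sub_of_le hr).symm).trans finSumFinEquiv.symm) j = s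
  cases s <;> simp

lemma blockMatrix_mulVec {p r : ℕ} (hr : r ≤ p) (τ : Equiv.Perm (Fin r)) (z : Fin p → ℝ)
    (j : Fin p) :
    (blockMatrix hr τ *ᵥ z) j = blockScale hr j * z (extendPerm hr τ j) := by
  simp only [blockMatrix, blockScale, extendPerm, Matrix.submatrix_mulVec_equiv,
    Function.comp_apply, Matrix.fromBlocks_mulVec, Equiv.permCongr_apply, Equiv.symm_symm,
    Matrix.zero_mulVec, add_zero, zero_add, Matrix.permMatrix_mulVec, Matrix.smul_mulVec,
    Matrix.one_mulVec]
  generalize ((finCongr (Nat.add_sub_of_le hr).symm).trans finSumFinEquiv.symm) j = s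
  cases s <;> simp

lemma blockMatrix_injective {p r : ℕ} (hr : r ≤ p) :
    Function.Injective (blockMatrix hr : Equiv.Perm (Fin r) → Matrix (Fin p) (Fin p) ℝ) := by
  intro τ τ' h
  ext i
  have := congrFun (congrFun h ((finCongr (Nat.add_sub_of_le hr)) (finSumFinEquiv (Sum.inl i))))
    ((finCongr (Nat.add_sub_of_le hr)) (finSumFinEquiv (Sum.inl (τ i))))
  simp only [blockMatrix, Matrix.submatrix_apply, Equiv.trans_apply, finCongr_apply, Fin.cast_cast,
    Fin.cast_eq_self, Equiv.symm_apply_apply, Matrix.fromBlocks_apply₁₁, Equiv.Perm.permMatrix,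
    PEquiv.toMatrix_apply, Equiv.toPEquiv_apply, Option.mem_def, Option.some.injEq] at this
  by_contra hne
  have hne' : τ' i ≠ τ i := fun h' => hne (by rw [h'])
  simp [hne'] at this

/-! ### Reduction of the network to a fixed diagonal network -/

/-- The parameter of `subclass` with input-layer vector `w` and permutations `τ`. -/
noncomputable def permParam {p r d : ℕ} (hr : r ≤ p) (w : Fin p → ℝ)
    (τ : Fin d → Equiv.Perm (Fin r)) : Param p d :=
  ⟨⟨fun _ => p, rfl, rfl⟩, (w, fun i => blockMatrix hr (τ i))⟩

/-- The layer-`i` state of the linear network whose weight matrices are all the diagonal matrix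
`blockScale`, driven by the noise vectors alone (`w_0 = 0`). -/
noncomputable def diagState {p r d : ℕ} (hr : r ≤ p) (e : Fin (d + 1) → Fin p → ℝ)
    (i : Fin (d + 1)) : Fin p → ℝ :=
  Fin.induction (motive := fun _ => Fin p → ℝ) (e 0)
    (fun i z j => blockScale hr j * z j + e i.succ j) i

lemma measurable_diagState {p r d : ℕ} (hr : r ≤ p) (i : Fin (d + 1)) :
    Measurable (fun e : Fin (d + 1) → Fin p → ℝ => diagState hr e i) := by
  induction i using Fin.induction with
  | zero => exact measurable_pi_apply 0
  | succ i ih =>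
    refine measurable_pi_lambda _ fun j => ?_
    simp only [diagState, Fin.induction_succ] at ih ⊢
    exact (((measurable_pi_apply j).comp ih).const_mul _).add (by fun_prop)

/-- The inverse of the product of the permutations of the layers after layer `i`, written through
partial products; it is the identity at the last layer. The state of the network at layer `i` is
the state of the diagonal network composed with it, once each noise vector `e_i` has been composed
with its inverse. -/
noncomputable def accPerm {p r d : ℕ} (hr : r ≤ p) (τ : Fin d → Equiv.Perm (Fin r))
    (i : Fin (d + 1)) : Equiv.Perm (Fin p) :=
  (Fin.partialProd (fun k => extendPerm hr (τ k)) (Fin.last d))⁻¹ *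
    Fin.partialProd (fun k => extendPerm hr (τ k)) i

lemma accPerm_last {p r d : ℕ} (hr : r ≤ p) (τ : Fin d → Equiv.Perm (Fin r)) :
    accPerm hr τ (Fin.last d) = 1 := by
  simp [accPerm]

lemma accPerm_succ {p r d : ℕ} (hr : r ≤ p) (τ : Fin d → Equiv.Perm (Fin r)) (i : Fin d) :
    accPerm hr τ i.succ = accPerm hr τ i.castSucc * extendPerm hr (τ i) := by
  simp [accPerm, Fin.partialProd_succ, mul_assoc]

lemma blockScale_accPerm {p r d : ℕ} (hr : r ≤ p) (τ : Fin d → Equiv.Perm (Fin r))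
    (i : Fin (d + 1)) (j : Fin p) : blockScale hr (accPerm hr τ i j) = blockScale hr j := by
  have h : ∀ i j, blockScale hr (Fin.partialProd (fun k => extendPerm hr (τ k)) i j) =
      blockScale hr j := by
    intro i
    induction i using Fin.induction with
    | zero => simp
    | succ i ih => intro j; simp [Fin.partialProd_succ, ih, blockScale_extendPerm]
  rw [accPerm, Equiv.Perm.mul_apply, ← h (Fin.last d), ← Equiv.Perm.mul_apply,
    mul_inv_cancel, Equiv.Perm.one_apply, h]

/-- The input vector enters the state only through the noise of the first layer, and the
permutations only through a relabelling of the coordinates of the noise vectors and of the state. -/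
lemma state_permParam {p r d : ℕ} (hr : r ≤ p) (w : Fin p → ℝ) (τ : Fin d → Equiv.Perm (Fin r))
    (y : ℝ) (e : Fin (d + 1) → Fin p → ℝ) (i : Fin (d + 1)) (j : Fin p) :
    state id (permParam hr w τ) y e i j =
      diagState hr (fun i k => e i ((accPerm hr τ i)⁻¹ k) +
        (if i = 0 then y * w ((accPerm hr τ i)⁻¹ k) else 0)) i (accPerm hr τ i j) := by
  induction i using Fin.induction generalizing j with
  | zero =>
    simp only [state, diagState, Fin.induction_zero, if_true, Equiv.Perm.inv_def,
      Equiv.symm_apply_apply]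
    exact add_comm (y * w j) (e 0 j)
  | succ i ih =>
    have hstep : state id (permParam hr w τ) y e i.succ j =
        blockScale hr j * state id (permParam hr w τ) y e i.castSucc (extendPerm hr (τ i) j) +
          e i.succ j := by
      simp only [state, Fin.induction_succ]
      exact congrArg (· + e i.succ j) (blockMatrix_mulVec hr (τ i) _ j)
    have hacc : accPerm hr τ i.castSucc (extendPerm hr (τ i) j) = accPerm hr τ i.succ j := by
      rw [accPerm_succ, Equiv.Perm.mul_apply]
    rw [hstep, ih, hacc]
    simp only [diagState, Fin.induction_succ]
    simp [blockScale_accPerm]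

/-! ### Gaussian noise -/

/-- Independent centred Gaussian noise vectors with covariance `v I`. -/
noncomputable def noiseLaw (p d : ℕ) (v : ℝ≥0) : Measure (Fin (d + 1) → Fin p → ℝ) :=
  Measure.pi fun _ => Measure.pi fun _ => gaussianReal 0 v

instance (p d : ℕ) (v : ℝ≥0) : IsProbabilityMeasure (noiseLaw p d v) := by
  unfold noiseLaw; infer_instance

lemma noiseLaw_map_perm_add {p d : ℕ} (v : ℝ≥0) (ρ : Fin (d + 1) → Equiv.Perm (Fin p))
    (m : Fin (d + 1) → Fin p → ℝ) :
    (noiseLaw p d v).map (fun e i k => e i (ρ i k) + m i k) =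
      Measure.pi fun i => Measure.pi fun k => gaussianReal (m i k) v := by
  have hinner : ∀ i, (Measure.pi fun _ : Fin p => gaussianReal 0 v).map
      (fun z k => z (ρ i k) + m i k) = Measure.pi fun k => gaussianReal (m i k) v := by
    intro i
    have h1 : (Measure.pi fun _ : Fin p => gaussianReal 0 v).map (fun z k => z (ρ i k)) =
        Measure.pi fun _ : Fin p => gaussianReal 0 v := by
      have := (measurePreserving_piCongrLeft (α := fun _ : Fin p => ℝ)
        (fun _ => gaussianReal 0 v) (ρ i)).symm _ |>.map_eq
      exact this
    have h2 : (fun (z : Fin p → ℝ) k => z (ρ i k) + m i k) =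
        (fun z k => z k + m i k) ∘ (fun z k => z (ρ i k)) := rfl
    rw [h2, ← Measure.map_map (by fun_prop) (by fun_prop), h1,
      Measure.pi_map_pi (f := fun k x => x + m i k) (by fun_prop)]
    simp [gaussianReal_map_add_const]
  have hprob : ∀ i, IsProbabilityMeasure ((Measure.pi fun _ : Fin p => gaussianReal 0 v).map
      (fun z k => z (ρ i k) + m i k)) := fun i => by rw [hinner]; infer_instance
  have := Measure.pi_map_pi
    (μ := fun _ : Fin (d + 1) => Measure.pi fun _ : Fin p => gaussianReal 0 v)
    (f := fun i z k => z (ρ i k) + m i k) (fun i => Measurable.aemeasurable (by fun_prop))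
  simp_rw [hinner] at this
  exact this

/-! ### Data laws and the common reference law -/

/-- The common reference law of a single observation: pure noise passed through the diagonal
network, with an independent label. -/
noncomputable def nullLaw {p r : ℕ} (d : ℕ) (hr : r ≤ p) (v : ℝ≥0) (lab : Measure Label) :
    Measure (Obs p) :=
  ((noiseLaw p d v).map (fun e => diagState hr e (Fin.last d))).prod lab

instance {p r : ℕ} (d : ℕ) (hr : r ≤ p) (v : ℝ≥0) (lab : Measure Label)
    [IsProbabilityMeasure lab] : IsProbabilityMeasure (nullLaw d hr v lab) := by
  have := Measure.isProbabilityMeasure_map (μ := noiseLaw p d v)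
    (measurable_diagState hr (Fin.last d)).aemeasurable
  unfold nullLaw; infer_instance

lemma output_permParam {p r d : ℕ} (hr : r ≤ p) (w : Fin p → ℝ) (τ : Fin d → Equiv.Perm (Fin r))
    (y : ℝ) (e : Fin (d + 1) → Fin p → ℝ) :
    output id (permParam hr w τ) y e =
      diagState hr (fun i k => e i ((accPerm hr τ i)⁻¹ k) +
        (if i = 0 then y * w ((accPerm hr τ i)⁻¹ k) else 0)) (Fin.last d) := by
  funext j
  have := state_permParam hr w τ y e (Fin.last d) j
  rw [accPerm_last] at this
  exact this

lemma measurable_permuted_noise {p r d : ℕ} (hr : r ≤ p) (w : Fin p → ℝ)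
    (τ : Fin d → Equiv.Perm (Fin r)) :
    Measurable (fun (a : Label × (Fin (d + 1) → Fin p → ℝ)) i k =>
      a.2 i ((accPerm hr τ i)⁻¹ k) +
        (if i = 0 then (a.1 : ℝ) * w ((accPerm hr τ i)⁻¹ k) else 0)) := by
  refine measurable_pi_lambda _ fun i => measurable_pi_lambda _ fun k => ?_
  split_ifs
  · have : Measurable fun a : Label × (Fin (d + 1) → Fin p → ℝ) => (a.1 : ℝ) :=
      measurable_subtype_coe.comp measurable_fst
    fun_prop
  · fun_prop

lemma measurable_output_permParam {p r d : ℕ} (hr : r ≤ p) (w : Fin p → ℝ)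
    (τ : Fin d → Equiv.Perm (Fin r)) :
    Measurable (fun a : Label × (Fin (d + 1) → Fin p → ℝ) =>
      output id (permParam hr w τ) (a.1 : ℝ) a.2) := by
  simp_rw [output_permParam]
  exact (measurable_diagState hr (Fin.last d)).comp (measurable_permuted_noise hr w τ)

lemma isProbabilityMeasure_dataLaw {p r d : ℕ} (hr : r ≤ p) (w : Fin p → ℝ)
    (τ : Fin d → Equiv.Perm (Fin r)) (v : ℝ≥0) (lab : Measure Label) [IsProbabilityMeasure lab] :
    IsProbabilityMeasure
      (dataLaw id lab (permParam hr w τ) (fun _ => Measure.pi fun _ => gaussianReal 0 v)) :=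
  Measure.isProbabilityMeasure_map (μ := lab.prod (noiseLaw p d v))
    ((measurable_output_permParam hr w τ).prodMk measurable_fst).aemeasurable

/-- The shift by `y w_0` of the first noise vector is the only source of information on the
parameter, and it costs the factor `exp (‖w_0‖² / v)`. -/
lemma secondMomentDominated_dataLaw {p r d : ℕ} (hr : r ≤ p) (w : Fin p → ℝ)
    (τ : Fin d → Equiv.Perm (Fin r)) {v : ℝ≥0} (hv : v ≠ 0) (lab : Measure Label)
    [IsProbabilityMeasure lab] :
    SecondMomentDominated
      (dataLaw id lab (permParam hr w τ) (fun _ => Measure.pi fun _ => gaussianReal 0 v))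
      (nullLaw d hr v lab) (ENNReal.ofReal (Real.exp ((∑ j, w j ^ 2) / v))) := by
  have hsq : ∀ y : Label, (y : ℝ) ^ 2 = 1 := by
    rintro ⟨y, rfl | rfl⟩ <;> norm_num
  refine SecondMomentDominated.map_prodMk (ν := noiseLaw p d v)
    (measurable_output_permParam hr w τ) fun y => ?_
  simp_rw [output_permParam]
  have hcomp := Measure.map_map (μ := noiseLaw p d v) (measurable_diagState hr (Fin.last d))
    ((measurable_permuted_noise hr w τ).comp (measurable_prodMk_left (x := y)))
  have hgauss := noiseLaw_map_perm_add v (fun i => (accPerm hr τ i)⁻¹)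
    (fun i k => if i = 0 then (y : ℝ) * w ((accPerm hr τ i)⁻¹ k) else 0)
  have hdom := (SecondMomentDominated.pi fun i => SecondMomentDominated.pi fun k =>
    secondMomentDominated_gaussianReal
      (if i = 0 then (y : ℝ) * w ((accPerm hr τ i)⁻¹ k) else 0) hv).map
    (measurable_diagState hr (Fin.last d))
  rw [← hgauss] at hdom
  have hconst : (∏ i : Fin (d + 1), ∏ k : Fin p, ENNReal.ofReal (Real.exp
      ((if i = 0 then (y : ℝ) * w ((accPerm hr τ i)⁻¹ k) else 0) ^ 2 / v))) =
      ENNReal.ofReal (Real.exp ((∑ j, w j ^ 2) / v)) := by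
    rw [Fin.prod_univ_succ]
    simp only [if_true, Fin.succ_ne_zero, if_false]
    rw [← ENNReal.ofReal_prod_of_nonneg (fun _ _ => (Real.exp_pos _).le), ← Real.exp_sum,
      ← Finset.sum_div]
    simp_rw [mul_pow, hsq, one_mul]
    rw [Equiv.sum_comp (accPerm hr τ 0)⁻¹ (fun k => w k ^ 2)]
    simp
  rw [hconst] at hdom
  exact hcomp ▸ hdom

/-! ### The testing bound -/

lemma lintegral_uniformOn_range {ι Θ : Type*} [Fintype ι] [MeasurableSpace Θ]
    [MeasurableSingletonClass Θ] {g : ι → Θ} (hg : Function.Injective g) (F : Θ → ℝ≥0∞) :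
    ∫⁻ θ, F θ ∂uniformOn (Set.range g) = (Fintype.card ι : ℝ≥0∞)⁻¹ * ∑ i, F (g i) := by
  have hrange : Set.range g = ↑(Finset.univ.map ⟨g, hg⟩) := by simp
  rw [uniformOn, ProbabilityTheory.cond, lintegral_smul_measure, hrange, lintegral_finset,
    Measure.count_apply_finset]
  simp

/-- A success event of the decoder is the union of sections `{θ} × A_θ` with disjoint `A_θ`, so the
success probabilities `p_θ = κ θ A_θ` satisfy `(∑ p_θ)² ≤ M ∑ p_θ² ≤ M c ∑ Q A_θ ≤ M c`, where `M`
is the number of hypotheses. -/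
lemma half_le_failure_of_dominated {ι Θ X : Type*} [Fintype ι] [Nonempty ι] [MeasurableSpace Θ]
    [MeasurableSingletonClass Θ] [MeasurableSpace X] {g : ι → Θ} (hg : Function.Injective g)
    (κ : Kernel Θ X) [IsMarkovKernel κ] (Q : Measure X) [IsProbabilityMeasure Q] {c : ℝ}
    (hc : 0 ≤ c) (hdom : ∀ i, SecondMomentDominated (κ (g i)) Q (ENNReal.ofReal c))
    (hcard : 4 * c ≤ Fintype.card ι) (f : X → Θ) :
    (1 / 2 : ℝ≥0∞) ≤ (uniformOn (Set.range g) ⊗ₘ κ) {q | f q.2 ≠ q.1} := by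
  have hπ : IsProbabilityMeasure (uniformOn (Set.range g)) :=
    isProbabilityMeasure_uniformOn (Set.finite_range g) (Set.range_nonempty g)
  set P := uniformOn (Set.range g) ⊗ₘ κ with hP
  -- The decoder need not be measurable: its failure set is replaced by a measurable hull.
  set B := toMeasurable P {q | f q.2 ≠ q.1} with hB
  have hBm : MeasurableSet B := measurableSet_toMeasurable _ _
  set A : ι → Set X := fun i => Prod.mk (g i) ⁻¹' Bᶜ with hA
  have hAm : ∀ i, MeasurableSet (A i) := fun i => measurable_prodMk_left hBm.compl
  have hAf : ∀ i, ∀ x ∈ A i, f x = g i := fun i x hx => by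
    by_contra hne
    exact hx (subset_toMeasurable P _ hne)
  have hdisj : Pairwise (Function.onFun Disjoint A) := fun i j hij =>
    Set.disjoint_left.2 fun x hi hj => hij (hg ((hAf i x hi).symm.trans (hAf j x hj)))
  have hQ : ∑ i, Q.real (A i) ≤ 1 := by
    rw [← measureReal_biUnion_finset (fun i _ j _ hij => hdisj hij) (fun i _ => hAm i)]
    exact measureReal_le_one
  have hM : (0 : ℝ) < Fintype.card ι := by exact_mod_cast Fintype.card_pos
  have hsum : (∑ i, (κ (g i)).real (A i)) ^ 2 ≤ (Fintype.card ι : ℝ) * c := by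
    calc (∑ i, (κ (g i)).real (A i)) ^ 2
        ≤ (Fintype.card ι : ℝ) * ∑ i, (κ (g i)).real (A i) ^ 2 := by
          simpa using sq_sum_le_card_mul_sum_sq (s := Finset.univ)
            (f := fun i => (κ (g i)).real (A i))
      _ ≤ (Fintype.card ι : ℝ) * ∑ i, c * Q.real (A i) := by
          gcongr with i
          exact (hdom i).measureReal_sq_le hc (hAm i)
      _ = (Fintype.card ι : ℝ) * c * ∑ i, Q.real (A i) := by rw [← Finset.mul_sum, mul_assoc]
      _ ≤ (Fintype.card ι : ℝ) * c := mul_le_of_le_one_right (by positivity) hQ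
  have hsum' : ∑ i, (κ (g i)).real (A i) ≤ Fintype.card ι / 2 := by
    refine le_of_sq_le_sq (hsum.trans ?_) (by positivity)
    nlinarith
  have hsucc : P.real Bᶜ ≤ 1 / 2 := by
    rw [Measure.real, hP, Measure.compProd_apply hBm.compl, lintegral_uniformOn_range hg,
      ENNReal.toReal_mul, ENNReal.toReal_sum (fun i _ => by finiteness), ENNReal.toReal_inv,
      ENNReal.toReal_natCast]
    calc _ ≤ (Fintype.card ι : ℝ)⁻¹ * (Fintype.card ι / 2) := by gcongr; exact hsum'
      _ = 1 / 2 := by field_simp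
  have hfail : 1 / 2 ≤ P.real B := by
    rw [probReal_compl_eq_one_sub hBm] at hsucc
    linarith
  rw [← measure_toMeasurable, ← ofReal_measureReal]
  calc (1 / 2 : ℝ≥0∞) = ENNReal.ofReal (1 / 2) := by
        rw [ENNReal.ofReal_div_of_pos (by norm_num)]; simp
    _ ≤ _ := ENNReal.ofReal_le_ofReal hfail

/-! ### The finite class of parameters -/

instance instMeasurableSingletonClassMatrix (k l : ℕ) :
    MeasurableSingletonClass (Matrix (Fin k) (Fin l) ℝ) :=
  inferInstanceAs (MeasurableSingletonClass (Fin k → Fin l → ℝ))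

instance instMeasurableSingletonClassParam (p d : ℕ) : MeasurableSingletonClass (Param p d) where
  measurableSet_singleton θ := by
    refine MeasurableSpace.measurableSet_iInf.2 fun m => ?_
    have : ((fun x => (⟨m, x⟩ : Param p d)) ⁻¹' {θ}).Subsingleton := fun a ha b hb => by
      have hab : (⟨m, a⟩ : Param p d) = ⟨m, b⟩ := Eq.trans ha (Eq.symm hb)
      exact eq_of_heq (Sigma.mk.inj_iff.1 hab).2
    exact this.measurableSet

/-- The element of `signVectors p` whose entry at `j` is positive exactly when `s j`. -/
noncomputable def signVector {p : ℕ} (s : Fin p → Bool) (j : Fin p) : ℝ :=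
  (if s j then 1 else -1) / √(2 ^ min (j.val + 1) (p - 1))

lemma range_signVector (p : ℕ) : Set.range (signVector (p := p)) = signVectors p := by
  ext w
  constructor
  · rintro ⟨s, rfl⟩ j
    cases h : s j <;> simp [signVector, h]
  · intro hw
    classical
    refine ⟨fun j => decide (w j = 1 / √(2 ^ min (j.val + 1) (p - 1))), funext fun j => ?_⟩
    by_cases h : w j = 1 / √(2 ^ min (j.val + 1) (p - 1))
    · simp only [signVector, h, decide_true, if_true]
    · simp only [signVector, h, decide_false]
      simpa using ((hw j).resolve_left h).symm

lemma signVector_injective (p : ℕ) : Function.Injective (signVector (p := p)) := by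
  intro s t h
  funext j
  have hpos : (0 : ℝ) < √(2 ^ min (j.val + 1) (p - 1)) := by positivity
  have := congrFun h j
  simp only [signVector, div_left_inj' hpos.ne'] at this
  cases hs : s j <;> cases ht : t j <;> simp [hs, ht] at this ⊢ <;> norm_num at this

lemma sum_signVector_sq_le_one {p : ℕ} (s : Fin p → Bool) : ∑ j, signVector s j ^ 2 ≤ 1 := by
  have hsq : ∀ j, signVector s j ^ 2 = (1 / 2) ^ min (j.val + 1) (p - 1) := fun j => by
    rw [signVector, div_pow, Real.sq_sqrt (by positivity)]
    cases s j <;> simp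
  simp_rw [hsq]
  cases p with
  | zero => simp
  | succ q =>
    -- The last two exponents agree, which makes the geometric sum exactly `1`.
    have hgeom : ∀ m : ℕ, ∑ j : Fin m, (1 / 2 : ℝ) ^ (j.val + 1) + (1 / 2) ^ m = 1 := by
      intro m
      induction m with
      | zero => simp
      | succ m ih =>
        rw [Fin.sum_univ_castSucc]
        simp only [Fin.val_castSucc, Fin.val_last]
        rw [pow_succ (1 / 2 : ℝ) m]
        linarith
    refine (Eq.trans ?_ (hgeom q)).le
    rw [Fin.sum_univ_castSucc]
    simp only [Fin.val_castSucc, Fin.val_last, Nat.add_sub_cancel]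
    rw [min_eq_right (Nat.le_succ q)]
    congr 1
    exact Finset.sum_congr rfl fun j _ => by rw [min_eq_left (Nat.succ_le_of_lt j.2)]

/-- The enumeration of `subclass d hr` by sign patterns and tuples of permutations. -/
noncomputable def classParam {p r d : ℕ} (hr : r ≤ p)
    (a : (Fin p → Bool) × (Fin d → Equiv.Perm (Fin r))) : Param p d :=
  permParam hr (signVector a.1) a.2

lemma range_classParam {p r d : ℕ} (hr : r ≤ p) :
    Set.range (classParam (d := d) hr) = subclass d hr := by
  ext θ
  constructor
  · rintro ⟨a, rfl⟩
    exact ⟨_, a.2, range_signVector p ▸ Set.mem_range_self a.1, rfl⟩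
  · rintro ⟨w, τ, hw, rfl⟩
    obtain ⟨s, rfl⟩ := (range_signVector p).symm ▸ hw
    exact ⟨(s, τ), rfl⟩

lemma classParam_injective {p r d : ℕ} (hr : r ≤ p) :
    Function.Injective (classParam (d := d) hr) := by
  rintro ⟨s, τ⟩ ⟨s', τ'⟩ h
  have h' := sigma_mk_injective h
  have h1 := signVector_injective p (congrArg Prod.fst h')
  have h2 := congrArg Prod.snd h'
  exact Prod.ext h1 (funext fun i => blockMatrix_injective hr (congrFun h2 i))

lemma exp_le_card {p d r n : ℕ} {σ : ℝ} (hσ : 0 < σ)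
    (hn : (n : ℝ) ≤ σ ^ 2 *
      ((d * (∑ i ∈ Finset.Icc 1 r, Real.log i) + p * Real.log 2 - Real.log 4) / 4)) :
    4 * Real.exp (1 / σ ^ 2) ^ n ≤
      Fintype.card ((Fin p → Bool) × (Fin d → Equiv.Perm (Fin r))) := by
  have hfact : ∑ i ∈ Finset.Icc 1 r, Real.log i = Real.log (r.factorial : ℝ) := by
    clear hn
    induction r with
    | zero => simp
    | succ r ih =>
      rw [Finset.sum_Icc_succ_top (by omega), ih, Nat.factorial_succ, Nat.cast_mul,
        Real.log_mul (by positivity) (by positivity), add_comm]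
  have hcard : (Fintype.card ((Fin p → Bool) × (Fin d → Equiv.Perm (Fin r))) : ℝ) =
      Real.exp (d * Real.log (r.factorial : ℝ) + p * Real.log 2) := by
    have hr0 : (0 : ℝ) < r.factorial := by exact_mod_cast r.factorial_pos
    rw [Real.exp_add, mul_comm (d : ℝ), mul_comm (p : ℝ), Real.exp_mul, Real.exp_mul,
      Real.exp_log hr0, Real.exp_log two_pos]
    simp [Fintype.card_perm, mul_comm]
  rw [hcard, ← Real.exp_nat_mul]
  nth_rewrite 1 [← Real.exp_log (show (0 : ℝ) < 4 by norm_num)]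
  rw [← Real.exp_add, Real.exp_le_exp, ← hfact]
  have hσ2 : 0 < σ ^ 2 := by positivity
  have h4 : (n : ℝ) * (1 / σ ^ 2) ≤
      (d * (∑ i ∈ Finset.Icc 1 r, Real.log i) + p * Real.log 2 - Real.log 4) / 4 := by
    rw [mul_one_div, div_le_iff₀ hσ2]
    linarith
  have h0 : 0 ≤ (n : ℝ) * (1 / σ ^ 2) := by positivity
  linarith

/-! ### The linear Gaussian subfamily -/

instance instIsProbabilityMeasureUniformLabel :
    IsProbabilityMeasure (uniformOn (Set.univ : Set Label)) :=
  isProbabilityMeasure_uniformOn Set.finite_univ ⟨⟨1, by simp⟩, trivial⟩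

/-- The data-generating kernel of `subFamily`: `n` i.i.d. observations given a parameter of
`subclass`. Off this finite set, which is null for the prior, the value is the reference law of the
dataset, a choice that makes measurability immediate. -/
lemma exists_dataset_kernel {p r : ℕ} (d n : ℕ) (hr : r ≤ p) (v : ℝ≥0) :
    ∃ κ : Kernel (Param p d) (Fin n → Obs p), IsMarkovKernel κ ∧ ∀ a, κ (classParam hr a) =
      Measure.pi fun _ => dataLaw id (uniformOn (Set.univ : Set Label)) (classParam hr a)
        (fun _ => Measure.pi fun _ => gaussianReal 0 v) := by
  classical
  set F : Param p d → Measure (Fin n → Obs p) := fun θ =>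
    if θ ∈ Set.range (classParam hr) then
      Measure.pi fun _ => dataLaw id (uniformOn (Set.univ : Set Label)) θ
        (fun _ => Measure.pi fun _ => gaussianReal 0 v)
    else Measure.pi fun _ => nullLaw d hr v (uniformOn Set.univ) with hF
  have hFm : Measurable F := by
    refine (measurable_const (a := Measure.pi fun _ => nullLaw d hr v
      (uniformOn Set.univ))).measurable_of_countable_ne
        ((Set.finite_range (classParam hr)).countable.mono fun θ hθ => ?_)
    by_contra hne
    exact hθ (if_neg hne).symm
  refine ⟨⟨F, hFm⟩, ⟨fun θ => ?_⟩, fun a => if_pos (Set.mem_range_self a)⟩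
  change IsProbabilityMeasure (F θ)
  by_cases h : θ ∈ Set.range (classParam hr)
  · obtain ⟨a, rfl⟩ := h
    have := isProbabilityMeasure_dataLaw hr (signVector a.1) a.2 v (uniformOn Set.univ)
    rw [hF]
    simp only [Set.mem_range_self, if_true]
    unfold classParam
    infer_instance
  · rw [hF]
    simp only [h, if_false]
    infer_instance

lemma subFamily_subset_fullFamily {p r : ℕ} (d n : ℕ) (hr : r ≤ p) (σ : ℝ) :
    subFamily d n hr σ ⊆ fullFamily p d n := by
  rintro P ⟨π, rfl, κ, hκ, h, rfl⟩
  refine ⟨_, ?_, κ, hκ, ?_, rfl⟩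
  · rw [← range_classParam]
    exact isProbabilityMeasure_uniformOn (Set.finite_range _) (Set.range_nonempty _)
  · filter_upwards [h] with θ ⟨μ, hμ, hκθ⟩
    exact ⟨μ, ⟨id, measurable_id, _, inferInstance, _, fun i => inferInstance, hμ⟩, hκθ⟩

lemma half_le_minimaxFailure_subFamily {p d r n : ℕ} (hr : r ≤ p) {σ : ℝ} (hσ : 0 < σ)
    (hn : (n : ℝ) ≤ σ ^ 2 *
      ((d * (∑ i ∈ Finset.Icc 1 r, Real.log i) + p * Real.log 2 - Real.log 4) / 4)) :
    (1 / 2 : ℝ≥0∞) ≤ minimaxFailure (subFamily d n hr σ) := by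
  have hv : (σ ^ 2).toNNReal ≠ 0 := by simpa using hσ.ne'
  obtain ⟨κ, hκ, hκa⟩ := exists_dataset_kernel d n hr (σ ^ 2).toNNReal
  have hmem : uniformOn (Set.range (classParam hr)) ⊗ₘ κ ∈ subFamily d n hr σ := by
    refine ⟨_, range_classParam hr ▸ rfl, κ, hκ, ?_, rfl⟩
    have hae : ∀ᵐ θ ∂uniformOn (Set.range (classParam (d := d) hr)),
        θ ∈ Set.range (classParam hr) := by
      rw [uniformOn]
      exact ae_cond_mem (Set.finite_range _).measurableSet
    filter_upwards [hae] with θ ⟨a, ha⟩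
    subst ha
    exact ⟨_, rfl, hκa a⟩
  have hdom : ∀ a, SecondMomentDominated (κ (classParam hr a))
      (Measure.pi fun _ => nullLaw d hr (σ ^ 2).toNNReal (uniformOn Set.univ))
      (ENNReal.ofReal (Real.exp (1 / σ ^ 2) ^ n)) := by
    intro a
    have := isProbabilityMeasure_dataLaw hr (signVector a.1) a.2 (σ ^ 2).toNNReal
      (uniformOn Set.univ)
    have h1 := SecondMomentDominated.pi fun _ : Fin n =>
      secondMomentDominated_dataLaw hr (signVector a.1) a.2 hv (uniformOn Set.univ)
    rw [hκa]
    refine h1.mono ?_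
    rw [Finset.prod_const, Finset.card_univ, Fintype.card_fin,
      ENNReal.ofReal_pow (Real.exp_pos _).le, Real.coe_toNNReal _ (sq_nonneg σ)]
    gcongr
    exact sum_signVector_sq_le_one a.1
  refine le_iInf fun f => le_trans ?_ (le_iSup₂ (f := fun P _ => failureProb f P) _ hmem)
  exact half_le_failure_of_dominated (classParam_injective hr) κ _ (by positivity) hdom
    (exp_le_card hσ hn) f

end DeepNet

theorem theorem3p2 (p d r n : ℕ) (hr : r ≤ p) (σ : ℝ) (hσ : 0 < σ)
    (hn : (n : ℝ) ≤ σ ^ 2 *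
      ((d * (∑ i ∈ Finset.Icc 1 r, Real.log i) + p * Real.log 2 - Real.log 4) / 4)) :
    (1 / 2 : ℝ≥0∞) ≤ DeepNet.minimaxFailure (DeepNet.fullFamily p d n) ∧
      DeepNet.subFamily d n hr σ ⊆ DeepNet.fullFamily p d n ∧
      (1 / 2 : ℝ≥0∞) ≤ DeepNet.minimaxFailure (DeepNet.subFamily d n hr σ) := by
  have hsub := DeepNet.subFamily_subset_fullFamily d n hr σ
  have hhalf := DeepNet.half_le_minimaxFailure_subFamily hr hσ hn
  exact ⟨hhalf.trans (iInf_mono fun f => biSup_mono hsub), hsub, hhalf⟩
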